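/- Conventions. A skew shape $\lambda/\mu$ is a pair of partitions $\mu\subseteq\lambda$ (rows and columns numbered from $0$, matrix orientation). $\mathrm{Tab}(\lambda/\mu)$ is the set of semistandard fillings of the squares of $\lambda/\mu$ with entries in $\mathbb N=\{0,1,2,\dots\}$: rows weakly increasing from left to right, columns strictly increasing from top to bottom. An inward jeu de taquin slide of $T\in\mathrm{Tab}(\lambda/\mu)$ into a corner $s$ of $\mu$ moves an empty square, starting at $s$: at each step the smaller of the entries to the right of and below the empty square moves into it (the lower one if they are equal), until there is no such entry; if the empty square is then $t$, the result is a tableau of shape $(\lambda\setminus\{t\})/(\mu\setminus\{s\})$. The outward slide into $t$ is the inverse operation. Two tableaux are jeu de taquin equivalent if one can be transformed into the other by a finite sequence of inward and outward slides. Two tableaux of the same shape are dual equivalent if applying any sequence of inward and outward slides (given by the squares slid into) to both of them yields two tableaux of the same shape. A tableau $\bar T\in\mathrm{Tab}(\nu/\kappa)$ is a companion tableau of $T\in\mathrm{Tab}(\chi)$ if for all $i,j\ge 0$ the number of entries $j$ in row $i$ of $T$ equals the number of entries $i$ in row $j$ of $\bar T$. The tableau $T$ is $\nu/\kappa$-dominant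 if it has a companion tableau of shape $\nu/\kappa$ (which is then unique). Corollary. Let $\chi,\chi'$ be skew shapes, let $T\in\mathrm{Tab}(\chi)$ and $T'\in\mathrm{Tab}(\chi')$ be jeu de taquin equivalent, and let $\nu/\kappa$ be a skew shape. Then $T$ is $\nu/\kappa$-dominant if and only if $T'$ is $\nu/\kappa$-dominant. In that case, the companion tableaux of $T$ and $T'$ of shape $\nu/\kappa$ are dual equivalent. -/

import Mathlib

/-- A skew shape `outer/inner`: a pair of partitions (as Young diagrams) with `inner ⊆ outer`.
Squares are pairs (row, column), numbered from 0, rows going downwards. -/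
structure SkewShape where
  outer : YoungDiagram
  inner : YoungDiagram
  inner_le : inner ≤ outer

/-- The squares of a skew shape. -/
def SkewShape.cells (χ : SkewShape) : Finset (ℕ × ℕ) :=
  χ.outer.cells \ χ.inner.cells

/-- Skew semistandard tableaux of shape `χ` with entries in `ℕ`: rows increase weakly from left to
right, columns increase strictly from top to bottom. The entry is set to `0` outside the shape, so
that equality of tableaux is equality of the fillings of the squares of `χ`. -/
@[ext]
structure SkewTab (χ : SkewShape) where
  entry : ℕ × ℕ → ℕ
  row_weak : ∀ i j j' : ℕ, j < j' → (i, j) ∈ χ.cells → (i, j') ∈ χ.cells →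
    entry (i, j) ≤ entry (i, j')
  col_strict : ∀ i i' j : ℕ, i < i' → (i, j) ∈ χ.cells → (i', j) ∈ χ.cells →
    entry (i, j) < entry (i', j)
  zeros : ∀ c : ℕ × ℕ, c ∉ χ.cells → entry c = 0

/-- A skew semistandard tableau together with its shape. -/
abbrev AnySkewTab : Type := Σ χ : SkewShape, SkewTab χ

/-- One move in an inward slide inside the diagram `lam`. A state consists of the position of the
empty square and of the current filling. Of the entries to the right of and below the empty square
the smaller one moves into it; if they are equal, the one below moves. -/
inductive HoleMove (lam : YoungDiagram) :
    (ℕ × ℕ) × (ℕ × ℕ → ℕ) → (ℕ × ℕ) × (ℕ × ℕ → ℕ) → Prop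
  | up (i j : ℕ) (f : ℕ × ℕ → ℕ) (hbelow : (i + 1, j) ∈ lam)
      (hmin : (i, j + 1) ∈ lam → f (i + 1, j) ≤ f (i, j + 1)) :
      HoleMove lam ((i, j), f) ((i + 1, j), Function.update f (i, j) (f (i + 1, j)))
  | left (i j : ℕ) (f : ℕ × ℕ → ℕ) (hright : (i, j + 1) ∈ lam)
      (hmin : (i + 1, j) ∈ lam → f (i, j + 1) < f (i + 1, j)) :
      HoleMove lam ((i, j), f) ((i, j + 1), Function.update f (i, j) (f (i, j + 1)))

/-- `T'` is the result of the inward jeu de taquin slide of `T` into the corner `s` of the inner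
partition, and this slide ends by vacating the corner `t` of the outer partition.
That `s` and `t` are corners is expressed by `inner \ {s}` and `outer \ {t}` being again Young
diagrams, namely the inner and outer partition of the new shape; in particular no square to the
right of or below `t` belongs to the diagram, so no further move is possible. -/
def IsInwardSlide (s t : ℕ × ℕ) (T T' : AnySkewTab) : Prop :=
  s ∈ T.1.inner ∧ T'.1.inner.cells = T.1.inner.cells.erase s ∧
  t ∈ T.1.outer ∧ T'.1.outer.cells = T.1.outer.cells.erase t ∧
  ∃ g : ℕ × ℕ → ℕ,
    Relation.ReflTransGen (HoleMove T.1.outer) (s, T.2.entry) (t, g) ∧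
    ∀ c ∈ T'.1.cells, T'.2.entry c = g c

/-- The two kinds of jeu de taquin slides, each with the square that the slide is into. -/
inductive JdtSlide
  | inward (s : ℕ × ℕ)
  | outward (t : ℕ × ℕ)

/-- `T'` is obtained from `T` by the given slide. The outward slide into the square `t` (a square
outside the outer partition, whose addition gives a partition) is the inverse of the inward slide
that vacates `t`. -/
def IsSlide : JdtSlide → AnySkewTab → AnySkewTab → Prop
  | .inward s, T, T' => ∃ t, IsInwardSlide s t T T'
  | .outward t, T, T' => ∃ s, IsInwardSlide s t T' T

/-- `T'` is obtained from `T` by successively performing the slides in the list. -/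
inductive IsSlideSeq : List JdtSlide → AnySkewTab → AnySkewTab → Prop
  | nil (T : AnySkewTab) : IsSlideSeq [] T T
  | cons (d : JdtSlide) (p : List JdtSlide) (T U V : AnySkewTab) :
      IsSlide d T U → IsSlideSeq p U V → IsSlideSeq (d :: p) T V

/-- Jeu de taquin equivalence: one tableau can be transformed into the other by a sequence of
inward and outward slides. -/
def JdtEquiv {χ χ' : SkewShape} (T : SkewTab χ) (T' : SkewTab χ') : Prop :=
  ∃ p : List JdtSlide, IsSlideSeq p ⟨χ, T⟩ ⟨χ', T'⟩

/-- Dual equivalence of two tableaux of the same shape: any sequence of (inward and outward) slides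
applied to both of them results in tableaux of the same shape. -/
def DualEquiv {χ : SkewShape} (T U : SkewTab χ) : Prop :=
  ∀ (p : List JdtSlide) (T' U' : AnySkewTab),
    IsSlideSeq p ⟨χ, T⟩ T' → IsSlideSeq p ⟨χ, U⟩ U' → T'.1 = U'.1

/-- The number of entries equal to `a` in row `i` of `T`. -/
def SkewTab.rowCount {χ : SkewShape} (T : SkewTab χ) (i a : ℕ) : ℕ :=
  (χ.cells.filter (fun c => c.1 = i ∧ T.entry c = a)).card

/-- `U` is a companion tableau of `T`: for all `i` and `a`, the number of entries `a` in row `i`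
of `T` equals the number of entries `i` in row `a` of `U`. -/
def IsCompanion {χ σ : SkewShape} (T : SkewTab χ) (U : SkewTab σ) : Prop :=
  ∀ i a : ℕ, T.rowCount i a = U.rowCount a i

/-- `T` is `σ`-dominant for a skew shape `σ = ν/κ`: it has a companion tableau of shape `σ`.
(This forces the weight of `T` to be `ν - κ`.) -/
def IsDominant {χ : SkewShape} (T : SkewTab χ) (σ : SkewShape) : Prop :=
  ∃ U : SkewTab σ, IsCompanion T U

/-! Encode a tableau by its matrix of row contents, entry `(i, a)` counting the `a`'s in row `i`; a
companion tableau has the transposed matrix. Given the shape, a matrix of natural numbers comes from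
a tableau exactly when its row sums are the row lengths and each row excess is at most the
difference of the starting columns of the two rows (column strictness).

While the hole moves right, an entry changes column but not row, so the matrix is unchanged. When it
moves down, an entry moves up one row, and this is the crystal raising operator on those two rows
(`IsPunctured.rowStep_up`). A slide is thus a chain of raising operators on successive pairs of
rows, which stops as soon as the excess respects the bound (`IsInwardSlide.rowChain`).

Row and column operators commute, and column operators preserve the maxima of the row excesses.
Slides of `T` act on companion matrices as column operators, so dominance is preserved. Companions
`U`, `U'` of the same shape are linked by column operators; slides of them are row chains, which
these operators carry along and which therefore stop in the same row. So shapes keep agreeing, and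
the link persists.

Integer matrices are used so that the operators need no nonnegativity check at intermediate stages.
-/

/-! ### Row excesses and elementary moves on matrices -/

/-- The excess of the entries at most `j` in row `i + 1` over the entries less than `j` in row `i`,
for a tableau with `M i b` entries `b` in row `i`. -/
def rowExcess (M : ℕ → ℕ → ℤ) (i j : ℕ) : ℤ :=
  ∑ b ∈ Finset.range (j + 1), M (i + 1) b - ∑ b ∈ Finset.range j, M i b

/-- The transposed matrix. -/
def swapMat (M : ℕ → ℕ → ℤ) : ℕ → ℕ → ℤ := fun a b => M b a

/-- Move one unit in column `j` from row `i + 1` to row `i`. -/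
def raiseRow (i j : ℕ) (M : ℕ → ℕ → ℤ) : ℕ → ℕ → ℤ := fun a b =>
  M a b + (if a = i ∧ b = j then 1 else 0) - (if a = i + 1 ∧ b = j then 1 else 0)

/-- Move one unit in column `j` from row `i` to row `i + 1`. -/
def lowerRow (i j : ℕ) (M : ℕ → ℕ → ℤ) : ℕ → ℕ → ℤ := fun a b =>
  M a b - (if a = i ∧ b = j then 1 else 0) + (if a = i + 1 ∧ b = j then 1 else 0)

/-- Move one unit in row `i` from column `j + 1` to column `j`. -/
def raiseCol (i j : ℕ) (M : ℕ → ℕ → ℤ) : ℕ → ℕ → ℤ := fun a b =>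
  M a b + (if a = i ∧ b = j then 1 else 0) - (if a = i ∧ b = j + 1 then 1 else 0)

/-- Move one unit in row `i` from column `j` to column `j + 1`. -/
def lowerCol (i j : ℕ) (M : ℕ → ℕ → ℤ) : ℕ → ℕ → ℤ := fun a b =>
  M a b - (if a = i ∧ b = j then 1 else 0) + (if a = i ∧ b = j + 1 then 1 else 0)

theorem raiseRow_lowerRow (i j : ℕ) (M : ℕ → ℕ → ℤ) : raiseRow i j (lowerRow i j M) = M := by
  funext a b; simp only [raiseRow, lowerRow]; ring

theorem lowerRow_raiseRow (i j : ℕ) (M : ℕ → ℕ → ℤ) : lowerRow i j (raiseRow i j M) = M := by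
  funext a b; simp only [raiseRow, lowerRow]; ring

theorem raiseCol_lowerCol (i j : ℕ) (M : ℕ → ℕ → ℤ) : raiseCol i j (lowerCol i j M) = M := by
  funext a b; simp only [raiseCol, lowerCol]; ring

theorem raiseRow_raiseCol_comm (i j k l : ℕ) (M : ℕ → ℕ → ℤ) :
    raiseRow i j (raiseCol k l M) = raiseCol k l (raiseRow i j M) := by
  funext a b; simp only [raiseRow, raiseCol]; ring

theorem raiseRow_raiseCol_exchange (i j : ℕ) (M : ℕ → ℕ → ℤ) :
    raiseRow i j (raiseCol (i + 1) j M) = raiseCol i j (raiseRow i (j + 1) M) := by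
  funext a b; simp only [raiseRow, raiseCol]; ring

theorem swapMat_raiseCol (i j : ℕ) (M : ℕ → ℕ → ℤ) :
    swapMat (raiseCol i j M) = raiseRow j i (swapMat M) := by
  funext a b; simp only [raiseRow, raiseCol, swapMat, and_comm]

theorem rowExcess_zero (M : ℕ → ℕ → ℤ) (i : ℕ) : rowExcess M i 0 = M (i + 1) 0 := by
  simp [rowExcess]

theorem rowExcess_succ (M : ℕ → ℕ → ℤ) (i j : ℕ) :
    rowExcess M i (j + 1) = rowExcess M i j + M (i + 1) (j + 1) - M i j := by
  simp only [rowExcess, Finset.sum_range_succ _ (j + 1), Finset.sum_range_succ (M i)]; ring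

/-- The increments of the row excess and of the column excess agree. -/
theorem rowExcess_sub_eq (M : ℕ → ℕ → ℤ) (i j : ℕ) :
    rowExcess M i (j + 1) - rowExcess M i j =
      rowExcess (swapMat M) j (i + 1) - rowExcess (swapMat M) j i := by
  rw [rowExcess_succ, rowExcess_succ]; simp only [swapMat]; ring

theorem rowExcess_raiseRow (i j : ℕ) (M : ℕ → ℕ → ℤ) (b : ℕ) :
    rowExcess (raiseRow i j M) i b =
      rowExcess M i b - (if j ≤ b then 1 else 0) - (if j < b then 1 else 0) := by
  induction b with
  | zero => simp only [rowExcess_zero, raiseRow]; grind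
  | succ b ih => rw [rowExcess_succ, rowExcess_succ, ih]; simp only [raiseRow]; grind

theorem rowExcess_raiseCol (i k j : ℕ) (M : ℕ → ℕ → ℤ) (b : ℕ) :
    rowExcess (raiseCol k j M) i b =
      rowExcess M i b - (if k = i ∧ b = j + 1 then 1 else 0)
        + (if k = i + 1 ∧ b = j then 1 else 0) := by
  induction b with
  | zero => simp only [rowExcess_zero, raiseCol]; grind
  | succ b ih => rw [rowExcess_succ, rowExcess_succ, ih]; simp only [raiseCol]; grind

theorem rowExcess_swapMat_raiseRow (i k j : ℕ) (M : ℕ → ℕ → ℤ) (b : ℕ) :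
    rowExcess (swapMat (raiseRow k j M)) i b =
      rowExcess (swapMat M) i b - (if j = i ∧ b = k + 1 then 1 else 0)
        + (if j = i + 1 ∧ b = k then 1 else 0) := by
  have h : swapMat (raiseRow k j M) = raiseCol j k (swapMat M) := by
    funext a b; simp only [raiseRow, raiseCol, swapMat, and_comm]
  rw [h, rowExcess_raiseCol]

/-- `f` attains its maximum `m` at `j` for the first time. -/
def IsFirstMax (f : ℕ → ℤ) (j : ℕ) (m : ℤ) : Prop :=
  f j = m ∧ (∀ b, f b ≤ m) ∧ ∀ b < j, f b < m

theorem IsFirstMax.unique {f : ℕ → ℤ} {j j' : ℕ} {m m' : ℤ} (h : IsFirstMax f j m)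
    (h' : IsFirstMax f j' m') : j = j' := by
  obtain ⟨h1, h2, h3⟩ := h
  obtain ⟨h1', h2', h3'⟩ := h'
  have a1 := h2 j'
  have a2 := h2' j
  rcases lt_trichotomy j j' with h | h | h
  · have := h3' j h; omega
  · exact h
  · have := h3 j' h; omega

/-- `f` attains its maximum `m` at `j` for the last time. -/
def IsLastMax (f : ℕ → ℤ) (j : ℕ) (m : ℤ) : Prop :=
  f j = m ∧ (∀ b, f b ≤ m) ∧ ∀ b, j < b → f b < m

theorem IsLastMax.unique {f : ℕ → ℤ} {j j' : ℕ} {m m' : ℤ} (h : IsLastMax f j m)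
    (h' : IsLastMax f j' m') : j = j' := by
  obtain ⟨h1, h2, h3⟩ := h
  obtain ⟨h1', h2', h3'⟩ := h'
  have a1 := h2 j'
  have a2 := h2' j
  rcases lt_trichotomy j j' with h | h | h
  · have := h3 j' h; omega
  · exact h
  · have := h3' j h; omega

/-! ### Raising operators -/

/-- The raising operator of a matrix on the rows `i` and `i + 1`, applied when the maximal
excess is `m + 1`. -/
def RowStep (i : ℕ) (m : ℤ) (M M' : ℕ → ℕ → ℤ) : Prop :=
  ∃ j, M' = raiseRow i j M ∧ IsFirstMax (rowExcess M i) j (m + 1)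

/-- The raising operator of a matrix on the columns `j` and `j + 1`. -/
def ColStep (j : ℕ) (n : ℤ) (M M' : ℕ → ℕ → ℤ) : Prop :=
  RowStep j n (swapMat M) (swapMat M')

/-- Raising in column `j` lowers the excess by 1 at `j` and by 2 beyond it, so the first maximum
becomes the last one. Hence raising is injective, with lowering at the last maximum as its inverse.
-/
theorem isLastMax_rowExcess_raiseRow_iff (i j : ℕ) (m : ℤ) (M : ℕ → ℕ → ℤ) :
    IsLastMax (rowExcess (raiseRow i j M) i) j m ↔ IsFirstMax (rowExcess M i) j (m + 1) := by
  simp only [IsLastMax, IsFirstMax, rowExcess_raiseRow]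
  constructor
  · rintro ⟨h1, h2, h3⟩
    refine ⟨by grind, fun b => ?_, fun b hb => ?_⟩
    · have := h2 b; have := h3 b; grind
    · have := h2 b; grind
  · rintro ⟨h1, h2, h3⟩
    refine ⟨by grind, fun b => ?_, fun b hb => ?_⟩
    · have := h2 b; have := h3 b; grind
    · have := h2 b; grind

theorem colStep_iff {j : ℕ} {n : ℤ} {M M' : ℕ → ℕ → ℤ} :
    ColStep j n M M' ↔
      ∃ i, M' = raiseCol i j M ∧ IsFirstMax (rowExcess (swapMat M) j) i (n + 1) := by
  refine exists_congr fun i => and_congr_left fun _ => ?_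
  rw [← swapMat_raiseCol]
  exact ⟨congrArg swapMat, fun h => by rw [h]⟩

theorem colStep_swapMat {j : ℕ} {n : ℤ} {M M' : ℕ → ℕ → ℤ} :
    ColStep j n (swapMat M) (swapMat M') ↔ RowStep j n M M' := Iff.rfl

theorem RowStep.unique {i : ℕ} {m m' : ℤ} {M M₁ M₂ : ℕ → ℕ → ℤ} (h₁ : RowStep i m M M₁)
    (h₂ : RowStep i m' M M₂) : M₁ = M₂ := by
  obtain ⟨j, rfl, h⟩ := h₁
  obtain ⟨j', rfl, h'⟩ := h₂
  rw [h.unique h']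

theorem RowStep.unique_left {i : ℕ} {m m' : ℤ} {M M₁ M₂ : ℕ → ℕ → ℤ} (h₁ : RowStep i m M₁ M)
    (h₂ : RowStep i m' M₂ M) : M₁ = M₂ := by
  obtain ⟨j, rfl, h⟩ := h₁
  obtain ⟨j', e, h'⟩ := h₂
  rw [← isLastMax_rowExcess_raiseRow_iff] at h h'
  rw [← e] at h'
  have := h.unique h'
  subst this
  rw [← lowerRow_raiseRow i j M₁, e, lowerRow_raiseRow]

/-! ### Commutation of row and column operators -/

/-- A column move changes the row excess by at most one, at `j` or `j + 1` only, and symmetrically.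
Since increments of the two excesses agree, either both first maxima stay put or both shift by one.
-/
theorem RowStep.colStep_comm {i j : ℕ} {m n : ℤ} {M M' N : ℕ → ℕ → ℤ} (hr : RowStep i m M M')
    (hc : ColStep j n M N) : ∃ N', RowStep i m N N' ∧ ColStep j n M' N' := by
  simp only [colStep_iff] at hc ⊢
  obtain ⟨b₀, rfl, h1, h2, h3⟩ := hr
  obtain ⟨a₀, rfl, g1, g2, g3⟩ := hc
  have key := rowExcess_sub_eq M i j
  have p1 := h2 j
  have p2 := h2 (j + 1)
  have p3 := h3 j
  have p4 := h3 (j + 1)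
  have q1 := g2 i
  have q2 := g2 (i + 1)
  have q3 := g3 i
  have q4 := g3 (i + 1)
  -- The shifting case: each move creates an earlier tie for the maximum of the other excess, so the
  -- second moves happen at `j` and `i` instead of `j + 1` and `i + 1`.
  by_cases hs : a₀ = i + 1 ∧ b₀ = j + 1 ∧ rowExcess M i (j + 1) = rowExcess M i j + 1
  · obtain ⟨rfl, rfl, hs⟩ := hs
    refine ⟨raiseRow i j (raiseCol (i + 1) j M), ⟨j, rfl, ?_⟩, i,
      raiseRow_raiseCol_exchange i j M, ?_⟩
    · simp only [IsFirstMax, rowExcess_raiseCol]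
      exact ⟨by grind, fun b => by have := h2 b; grind, fun b hb => by have := h3 b; grind⟩
    · simp only [IsFirstMax, rowExcess_swapMat_raiseRow]
      exact ⟨by grind, fun b => by have := g2 b; grind, fun b hb => by have := g3 b; grind⟩
  · refine ⟨raiseRow i b₀ (raiseCol a₀ j M), ⟨b₀, rfl, ?_⟩, a₀,
      raiseRow_raiseCol_comm i b₀ a₀ j M, ?_⟩
    · simp only [IsFirstMax, rowExcess_raiseCol]
      exact ⟨by grind, fun b => by have := h2 b; grind, fun b hb => by have := h3 b; grind⟩
    · simp only [IsFirstMax, rowExcess_swapMat_raiseRow]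
      exact ⟨by grind, fun b => by have := g2 b; grind, fun b hb => by have := g3 b; grind⟩

theorem RowStep.colStep_exchange {i j : ℕ} {m n : ℤ} {M M' N' : ℕ → ℕ → ℤ}
    (hr : RowStep i m M M') (hc : ColStep j n M' N') :
    ∃ N, ColStep j n M N ∧ RowStep i m N N' := by
  simp only [colStep_iff] at hc ⊢
  obtain ⟨b₀, rfl, h1, h2, h3⟩ := hr
  obtain ⟨a₀, rfl, g1, g2, g3⟩ := hc
  have key := rowExcess_sub_eq M i j
  simp only [rowExcess_swapMat_raiseRow] at g1 g2 g3
  have p1 := h2 j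
  have p2 := h2 (j + 1)
  have p3 := h3 j
  have p4 := h3 (j + 1)
  have q1 := g2 i
  have q2 := g2 (i + 1)
  have q3 := g3 i
  have q4 := g3 (i + 1)
  -- The shifting case again. That the increments equal 1 need not be assumed here: the first
  -- maximum at `j + 1` forces a rise of the column excess from `i` to `i + 1`, and the row move
  -- raises the value at `i` by only 1.
  by_cases hs : a₀ = i ∧ b₀ = j + 1
  · obtain ⟨rfl, rfl⟩ := hs
    refine ⟨raiseCol (a₀ + 1) j M, ⟨a₀ + 1, rfl, ?_⟩, j,
      (raiseRow_raiseCol_exchange a₀ j M).symm, ?_⟩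
    · exact ⟨by grind, fun b => by have := g2 b; grind, fun b hb => by
        have := g2 b; have := g3 b; grind⟩
    · simp only [IsFirstMax, rowExcess_raiseCol]
      exact ⟨by grind, fun b => by have := h2 b; grind, fun b hb => by have := h3 b; grind⟩
  · refine ⟨raiseCol a₀ j M, ⟨a₀, rfl, ?_⟩, b₀, (raiseRow_raiseCol_comm i b₀ a₀ j M).symm, ?_⟩
    · exact ⟨by grind, fun b => by have := g2 b; grind, fun b hb => by
        have := g2 b; have := g3 b; grind⟩
    · simp only [IsFirstMax, rowExcess_raiseCol]
      exact ⟨by grind, fun b => by have := h2 b; grind, fun b hb => by have := h3 b; grind⟩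

theorem rowStep_iff_lowerRow {i : ℕ} {m : ℤ} {M M' : ℕ → ℕ → ℤ} :
    RowStep i m M M' ↔ ∃ j, M = lowerRow i j M' ∧ IsLastMax (rowExcess M' i) j m := by
  refine exists_congr fun j => ⟨?_, ?_⟩
  · rintro ⟨rfl, h⟩
    exact ⟨(lowerRow_raiseRow i j M).symm, (isLastMax_rowExcess_raiseRow_iff i j m M).2 h⟩
  · rintro ⟨rfl, h⟩
    refine ⟨(raiseRow_lowerRow i j M').symm, ?_⟩
    rwa [← isLastMax_rowExcess_raiseRow_iff, raiseRow_lowerRow]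

theorem colStep_iff_lowerCol {j : ℕ} {n : ℤ} {M M' : ℕ → ℕ → ℤ} :
    ColStep j n M M' ↔
      ∃ i, M = lowerCol i j M' ∧ IsLastMax (rowExcess (swapMat M') j) i n := by
  rw [ColStep, rowStep_iff_lowerRow]
  refine exists_congr fun i => and_congr_left fun _ => ?_
  have : swapMat (lowerCol i j M') = lowerRow j i (swapMat M') := by
    funext a b; simp only [lowerRow, lowerCol, swapMat, and_comm]
  rw [← this]
  exact ⟨congrArg swapMat, fun h => by rw [h]⟩

theorem rowExcess_lowerCol (i k j : ℕ) (M : ℕ → ℕ → ℤ) (b : ℕ) :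
    rowExcess (lowerCol k j M) i b =
      rowExcess M i b + (if k = i ∧ b = j + 1 then 1 else 0)
        - (if k = i + 1 ∧ b = j then 1 else 0) := by
  have := rowExcess_raiseCol i k j (lowerCol k j M) b
  rw [raiseCol_lowerCol] at this
  rw [this]; ring

theorem rowExcess_swapMat_lowerRow (i k j : ℕ) (M : ℕ → ℕ → ℤ) (b : ℕ) :
    rowExcess (swapMat (lowerRow k j M)) i b =
      rowExcess (swapMat M) i b + (if j = i ∧ b = k + 1 then 1 else 0)
        - (if j = i + 1 ∧ b = k then 1 else 0) := by
  have := rowExcess_swapMat_raiseRow i k j (lowerRow k j M) b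
  rw [raiseRow_lowerRow] at this
  rw [this]; ring

theorem RowStep.colStep_comm_left {i j : ℕ} {m n : ℤ} {M M' N' : ℕ → ℕ → ℤ}
    (hr : RowStep i m M M') (hc : ColStep j n N' M') :
    ∃ N, ColStep j n N M ∧ RowStep i m N N' := by
  simp only [colStep_iff_lowerCol] at hc ⊢
  simp only [rowStep_iff_lowerRow] at hr ⊢
  obtain ⟨b₀, rfl, h1, h2, h3⟩ := hr
  obtain ⟨a₀, rfl, g1, g2, g3⟩ := hc
  have key := rowExcess_sub_eq M' i j
  have p1 := h2 j
  have p2 := h2 (j + 1)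
  have p3 := h3 j
  have p4 := h3 (j + 1)
  have q1 := g2 i
  have q2 := g2 (i + 1)
  have q3 := g3 i
  have q4 := g3 (i + 1)
  -- For lowering, last maxima matter: a later tie is created, and the moves shift one place onward.
  by_cases hs : a₀ = i ∧ b₀ = j ∧ rowExcess M' i (j + 1) = rowExcess M' i j - 1
  · obtain ⟨rfl, rfl, hs⟩ := hs
    refine ⟨lowerCol (a₀ + 1) b₀ (lowerRow a₀ b₀ M'), ⟨a₀ + 1, rfl, ?_⟩, b₀ + 1, ?_, ?_⟩
    · simp only [IsLastMax, rowExcess_swapMat_lowerRow]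
      exact ⟨by grind, fun b => by have := g2 b; grind, fun b hb => by have := g3 b; grind⟩
    · funext a b; simp only [lowerRow, lowerCol]; ring
    · simp only [IsLastMax, rowExcess_lowerCol]
      exact ⟨by grind, fun b => by have := h2 b; grind, fun b hb => by have := h3 b; grind⟩
  · refine ⟨lowerCol a₀ j (lowerRow i b₀ M'), ⟨a₀, rfl, ?_⟩, b₀, ?_, ?_⟩
    · simp only [IsLastMax, rowExcess_swapMat_lowerRow]
      exact ⟨by grind, fun b => by have := g2 b; grind, fun b hb => by have := g3 b; grind⟩
    · funext a b; simp only [lowerRow, lowerCol]; ring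
    · simp only [IsLastMax, rowExcess_lowerCol]
      exact ⟨by grind, fun b => by have := h2 b; grind, fun b hb => by have := h3 b; grind⟩

/-- A move in row `i` lowers the value at `j + 1`, which was at most the one at `j`; a move in row
`i + 1` raises the value at `j`, which was strictly below the one at `j + 1`. Both comparisons come
from the first maximum of the column excess. -/
theorem ColStep.rowExcess_le_iff {j : ℕ} {n : ℤ} {M M' : ℕ → ℕ → ℤ} (h : ColStep j n M M')
    (i : ℕ) (c : ℤ) : (∀ b, rowExcess M' i b ≤ c) ↔ ∀ b, rowExcess M i b ≤ c := by
  obtain ⟨a₀, rfl, g1, g2, g3⟩ := colStep_iff.1 h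
  have key := rowExcess_sub_eq M i j
  have q1 := g2 i
  have q2 := g2 (i + 1)
  have q3 := g3 i
  have q4 := g3 (i + 1)
  simp only [rowExcess_raiseCol]
  constructor <;>
  · intro h b
    have p0 := h b
    have p1 := h j
    have p2 := h (j + 1)
    grind

/-! ### Column equivalence and chains of row operators -/

/-- Two matrices are related by one raising or lowering operator on columns. -/
def ColAdj (M N : ℕ → ℕ → ℤ) : Prop :=
  ∃ j n, ColStep j n M N ∨ ColStep j n N M

/-- Two matrices are connected by raising and lowering operators on columns. -/
def ColEquiv : (ℕ → ℕ → ℤ) → (ℕ → ℕ → ℤ) → Prop := Relation.ReflTransGen ColAdj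

theorem ColAdj.symm {M N : ℕ → ℕ → ℤ} (h : ColAdj M N) : ColAdj N M := by
  obtain ⟨j, n, h⟩ := h
  exact ⟨j, n, h.symm⟩

theorem ColEquiv.symm {M N : ℕ → ℕ → ℤ} (h : ColEquiv M N) : ColEquiv N M := by
  induction h with
  | refl => exact .refl
  | tail _ h ih => exact .head h.symm ih

theorem ColEquiv.rowExcess_le_iff {M M' : ℕ → ℕ → ℤ} (h : ColEquiv M M') (i : ℕ) (c : ℤ) :
    (∀ b, rowExcess M' i b ≤ c) ↔ ∀ b, rowExcess M i b ≤ c := by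
  induction h with
  | refl => exact Iff.rfl
  | tail _ h ih =>
    obtain ⟨j, n, h | h⟩ := h
    · rw [h.rowExcess_le_iff, ih]
    · rw [← h.rowExcess_le_iff, ih]

theorem RowStep.colEquiv_right {i : ℕ} {m : ℤ} {M M' N : ℕ → ℕ → ℤ} (hr : RowStep i m M M')
    (hc : ColEquiv M N) : ∃ N', RowStep i m N N' ∧ ColEquiv M' N' := by
  induction hc with
  | refl => exact ⟨M', hr, .refl⟩
  | tail _ h ih =>
    obtain ⟨K, hK, hc⟩ := ih
    obtain ⟨j, n, h | h⟩ := h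
    · obtain ⟨N', h1, h2⟩ := hK.colStep_comm h
      exact ⟨N', h1, hc.tail ⟨j, n, .inl h2⟩⟩
    · obtain ⟨N', h1, h2⟩ := RowStep.colStep_exchange h (colStep_swapMat.2 hK)
      exact ⟨swapMat N', h1, hc.tail ⟨j, n, .inr h2⟩⟩

theorem RowStep.colEquiv_left {i : ℕ} {m : ℤ} {M M' N' : ℕ → ℕ → ℤ} (hr : RowStep i m M M')
    (hc : ColEquiv M' N') : ∃ N, RowStep i m N N' ∧ ColEquiv M N := by
  induction hc with
  | refl => exact ⟨M, hr, .refl⟩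
  | tail _ h ih =>
    obtain ⟨K, hK, hc⟩ := ih
    obtain ⟨j, n, h | h⟩ := h
    · obtain ⟨N, h1, h2⟩ := hK.colStep_exchange h
      exact ⟨N, h2, hc.tail ⟨j, n, .inl h1⟩⟩
    · obtain ⟨N, h1, h2⟩ := hK.colStep_comm_left h
      exact ⟨N, h2, hc.tail ⟨j, n, .inr h1⟩⟩

/-- One step of a chain of raising operators on successive pairs of rows, for a skew tableau with
row `i` starting in column `μ i`. -/
def RowChainStep (μ : ℕ → ℤ) (x y : ℕ × (ℕ → ℕ → ℤ)) : Prop :=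
  y.1 = x.1 + 1 ∧ RowStep x.1 (μ x.1 - μ (x.1 + 1)) x.2 y.2

/-- A chain of raising operators on successive pairs of rows. -/
def RowChain (μ : ℕ → ℤ) : ℕ × (ℕ → ℕ → ℤ) → ℕ × (ℕ → ℕ → ℤ) → Prop :=
  Relation.ReflTransGen (RowChainStep μ)

theorem RowChain.colEquiv_right {μ : ℕ → ℤ} {x y : ℕ × (ℕ → ℕ → ℤ)} (h : RowChain μ x y)
    {N : ℕ → ℕ → ℤ} (hN : ColEquiv x.2 N) :
    ∃ N', RowChain μ (x.1, N) (y.1, N') ∧ ColEquiv y.2 N' := by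
  induction h with
  | refl => exact ⟨N, .refl, hN⟩
  | tail _ h ih =>
    obtain ⟨K, h1, h2⟩ := ih
    obtain ⟨N', h3, h4⟩ := h.2.colEquiv_right h2
    exact ⟨N', h1.tail ⟨h.1, h3⟩, h4⟩

theorem RowChain.colEquiv_left {μ : ℕ → ℤ} {x y : ℕ × (ℕ → ℕ → ℤ)} (h : RowChain μ x y)
    {N' : ℕ → ℕ → ℤ} (hN' : ColEquiv y.2 N') :
    ∃ N, RowChain μ (x.1, N) (y.1, N') ∧ ColEquiv x.2 N := by
  induction h using Relation.ReflTransGen.head_induction_on with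
  | refl => exact ⟨N', .refl, hN'⟩
  | head h _ ih =>
    obtain ⟨K, h1, h2⟩ := ih
    obtain ⟨N, h3, h4⟩ := h.2.colEquiv_left h2
    exact ⟨N, .head (b := (_, K)) ⟨h.1, h3⟩ h1, h4⟩

/-- A chain of raising operators is determined by its start if it cannot be continued. -/
theorem RowChain.unique {μ : ℕ → ℤ} {x y z : ℕ × (ℕ → ℕ → ℤ)} (hy : RowChain μ x y)
    (hz : RowChain μ x z) (ty : ∀ b, rowExcess y.2 y.1 b ≤ μ y.1 - μ (y.1 + 1))
    (tz : ∀ b, rowExcess z.2 z.1 b ≤ μ z.1 - μ (z.1 + 1)) : y = z := by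
  -- Steps are functional, so one of two chains from `x` extends the other; the extra steps would
  -- need an excess above the bound.
  have hru : Relator.RightUnique (RowChainStep μ) := fun a b c hb hc =>
    Prod.ext (hb.1.trans hc.1.symm) (hb.2.unique hc.2)
  have key : ∀ y z : ℕ × (ℕ → ℕ → ℤ), RowChain μ y z →
      (∀ b, rowExcess y.2 y.1 b ≤ μ y.1 - μ (y.1 + 1)) → y = z := by
    intro y z h t
    rcases h.cases_head with h | ⟨w, ⟨-, j, -, h, -⟩, -⟩
    · exact h
    · have := t j; omega
  rcases Relation.ReflTransGen.total_of_right_unique hru hy hz with h | h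
  · exact key y z h ty
  · exact (key z y h tz).symm

/-- A chain of raising operators is determined by its end if it cannot be prolonged backwards. -/
theorem RowChain.unique_left {μ : ℕ → ℤ} {x y z : ℕ × (ℕ → ℕ → ℤ)} (hx : RowChain μ x z)
    (hy : RowChain μ y z)
    (tx : ∀ i, x.1 = i + 1 → ∀ b, rowExcess x.2 i b < μ i - μ (i + 1))
    (ty : ∀ i, y.1 = i + 1 → ∀ b, rowExcess y.2 i b < μ i - μ (i + 1)) : x = y := by
  have hru : Relator.RightUnique (Function.swap (RowChainStep μ)) := by
    rintro ⟨a, A⟩ ⟨b, B⟩ ⟨c, C⟩ ⟨hb, hB⟩ ⟨hc, hC⟩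
    dsimp only at hb hB hc hC
    obtain rfl : b = c := by omega
    rw [hB.unique_left hC]
  have key : ∀ x y : ℕ × (ℕ → ℕ → ℤ), RowChain μ x y →
      (∀ i, y.1 = i + 1 → ∀ b, rowExcess y.2 i b < μ i - μ (i + 1)) → x = y := by
    intro x y h t
    rcases h.cases_tail with h | ⟨w, -, hw, hs⟩
    · exact h.symm
    · obtain ⟨j, -, h, -⟩ := rowStep_iff_lowerRow.1 hs
      have := t _ hw j
      omega
  rcases Relation.ReflTransGen.total_of_right_unique hru
    (Relation.reflTransGen_swap.2 hx) (Relation.reflTransGen_swap.2 hy) with h | h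
  · exact (key y x (Relation.reflTransGen_swap.1 h) tx).symm
  · exact key x y (Relation.reflTransGen_swap.1 h) ty

theorem RowChain.colEquiv_swapMat {μ : ℕ → ℤ} {x y : ℕ × (ℕ → ℕ → ℤ)} (h : RowChain μ x y) :
    ColEquiv (swapMat x.2) (swapMat y.2) := by
  induction h with
  | refl => exact .refl
  | tail _ h ih => exact ih.tail ⟨_, _, .inl h.2⟩

/-- Column operators preserve the row sums. -/
theorem ColEquiv.sum_row {M N : ℕ → ℕ → ℤ} (h : ColEquiv M N) (i : ℕ) (s : ℤ)
    (hs : ∀ᶠ k in Filter.atTop, ∑ b ∈ Finset.range k, M i b = s) :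
    ∀ᶠ k in Filter.atTop, ∑ b ∈ Finset.range k, N i b = s := by
  have key : ∀ (a j : ℕ) (M : ℕ → ℕ → ℤ), ∀ᶠ k in Filter.atTop,
      ∑ b ∈ Finset.range k, raiseCol a j M i b = ∑ b ∈ Finset.range k, M i b := by
    intro a j M
    -- The partial sum must contain both columns `j` and `j + 1`.
    filter_upwards [Filter.eventually_gt_atTop (j + 1)] with k hk
    simp only [raiseCol, Finset.sum_add_distrib, Finset.sum_sub_distrib]
    by_cases ha : i = a
    · have hj : j < k := by omega
      simp [ha, hk, hj]
    · simp [ha]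
  induction h with
  | refl => exact hs
  | tail _ h ih =>
    obtain ⟨j, n, h | h⟩ := h
    · obtain ⟨a, rfl, -⟩ := colStep_iff.1 h
      filter_upwards [ih, key a j _] with k h1 h2
      rw [h2, h1]
    · obtain ⟨a, rfl, -⟩ := colStep_iff.1 h
      filter_upwards [ih, key a j _] with k h1 h2
      rw [← h2, h1]

/-! ### Content matrices of fillings -/

theorem SkewShape.mem_cells {χ : SkewShape} {i c : ℕ} :
    (i, c) ∈ χ.cells ↔ χ.inner.rowLen i ≤ c ∧ c < χ.outer.rowLen i := by
  rw [SkewShape.cells, Finset.mem_sdiff, YoungDiagram.mem_cells, YoungDiagram.mem_cells,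
    YoungDiagram.mem_iff_lt_rowLen, YoungDiagram.mem_iff_lt_rowLen]
  omega

/-- The length of row `i` of a diagram, as an integer. -/
def rowLenInt (μ : YoungDiagram) (i : ℕ) : ℤ := μ.rowLen i

/-- The number of squares of `S` in row `i` that are filled with `a` by `f`. -/
def countMat (S : Finset (ℕ × ℕ)) (f : ℕ × ℕ → ℕ) : ℕ → ℕ → ℤ := fun i a =>
  ((S.filter (fun c => c.1 = i ∧ f c = a)).card : ℤ)

theorem countMat_congr {S : Finset (ℕ × ℕ)} {f g : ℕ × ℕ → ℕ} (h : ∀ c ∈ S, f c = g c) :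
    countMat S f = countMat S g := by
  funext i a
  unfold countMat
  congr 2
  exact Finset.filter_congr fun c hc => by rw [h c hc]

/-- The columns of the squares of `S` in row `i` whose entry is less than `j`. -/
def lowCols (S : Finset (ℕ × ℕ)) (f : ℕ × ℕ → ℕ) (i j : ℕ) : Finset ℕ :=
  (S.filter (fun c => c.1 = i ∧ f c < j)).image Prod.snd

theorem mem_lowCols {S : Finset (ℕ × ℕ)} {f : ℕ × ℕ → ℕ} {i j c : ℕ} :
    c ∈ lowCols S f i j ↔ (i, c) ∈ S ∧ f (i, c) < j := by
  simp only [lowCols, Finset.mem_image, Finset.mem_filter, Prod.exists]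
  constructor
  · rintro ⟨a, b, ⟨h1, rfl, h2⟩, rfl⟩
    exact ⟨h1, h2⟩
  · rintro ⟨h1, h2⟩
    exact ⟨i, c, ⟨h1, rfl, h2⟩, rfl⟩

theorem card_lowCols (S : Finset (ℕ × ℕ)) (f : ℕ × ℕ → ℕ) (i j : ℕ) :
    ((lowCols S f i j).card : ℤ) = ∑ b ∈ Finset.range j, countMat S f i b := by
  have h1 : (lowCols S f i j).card = (S.filter (fun c => c.1 = i ∧ f c < j)).card := by
    refine Finset.card_image_of_injOn fun x hx y hy hxy => ?_
    simp only [Finset.coe_filter, Set.mem_ofPred_eq] at hx hy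
    exact Prod.ext (hx.2.1.trans hy.2.1.symm) hxy
  rw [h1]
  simp only [countMat]
  rw [Finset.card_eq_sum_card_fiberwise (f := f) (t := Finset.range j)]
  · push_cast
    refine Finset.sum_congr rfl fun b hb => ?_
    rw [Finset.filter_filter]
    congr 2
    refine Finset.filter_congr fun c _ => ?_
    have := Finset.mem_range.1 hb
    constructor <;> rintro h <;> omega
  · intro x hx
    simp only [Finset.coe_filter, Set.mem_ofPred_eq] at hx
    simpa using hx.2.2

theorem rowExcess_countMat (S : Finset (ℕ × ℕ)) (f : ℕ × ℕ → ℕ) (i j : ℕ) :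
    rowExcess (countMat S f) i j =
      ((lowCols S f (i + 1) (j + 1)).card : ℤ) - ((lowCols S f i j).card : ℤ) := by
  rw [card_lowCols, card_lowCols, rowExcess]

/-! ### Slides as chains of raising operators -/

/-- The conditions for a semistandard filling, with the square `h` left empty. -/
structure IsPunctured (θ : SkewShape) (h : ℕ × ℕ) (f : ℕ × ℕ → ℕ) : Prop where
  hole_mem : h ∈ θ.cells
  row_weak : ∀ i c c', c < c' → (i, c) ∈ θ.cells → (i, c) ≠ h → (i, c') ∈ θ.cells →
    (i, c') ≠ h → f (i, c) ≤ f (i, c')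
  col_strict : ∀ i i' c, i < i' → (i, c) ∈ θ.cells → (i, c) ≠ h → (i', c) ∈ θ.cells →
    (i', c) ≠ h → f (i, c) < f (i', c)

theorem rowLen_succ_le (μ : YoungDiagram) (i : ℕ) : μ.rowLen (i + 1) ≤ μ.rowLen i :=
  μ.rowLen_anti _ _ (Nat.le_succ i)

/-- Small entries of row `i + 1` either lie left of the start of row `i`, which accounts for the
bound, or have a smaller entry of row `i` above them. -/
theorem rowExcess_le_of_subset {θ : SkewShape} {S : Finset (ℕ × ℕ)} {f : ℕ × ℕ → ℕ} {i j : ℕ}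
    (hS : S ⊆ θ.cells)
    (h : ∀ c, (i + 1, c) ∈ S → f (i + 1, c) ≤ j → θ.inner.rowLen i ≤ c →
      (i, c) ∈ S ∧ f (i, c) < j) :
    rowExcess (countMat S f) i j ≤ rowLenInt θ.inner i - rowLenInt θ.inner (i + 1) := by
  have hsub : lowCols S f (i + 1) (j + 1) ⊆
      Finset.Ico (θ.inner.rowLen (i + 1)) (θ.inner.rowLen i) ∪ lowCols S f i j := by
    intro c hc
    rw [mem_lowCols] at hc
    rw [Finset.mem_union, Finset.mem_Ico, mem_lowCols]
    have h1 := SkewShape.mem_cells.1 (hS hc.1)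
    by_cases h2 : θ.inner.rowLen i ≤ c
    · exact .inr (h c hc.1 (by omega) h2)
    · exact .inl ⟨h1.1, by omega⟩
  have h1 := (Finset.card_le_card hsub).trans (Finset.card_union_le _ _)
  rw [Nat.card_Ico] at h1
  have h2 := rowLen_succ_le θ.inner i
  rw [rowExcess_countMat, rowLenInt, rowLenInt]
  omega

theorem SkewTab.rowExcess_le {χ : SkewShape} (T : SkewTab χ) (i j : ℕ) :
    rowExcess (countMat χ.cells T.entry) i j ≤
      rowLenInt χ.inner i - rowLenInt χ.inner (i + 1) := by
  refine rowExcess_le_of_subset subset_rfl fun c hc hj hi => ?_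
  have h1 := SkewShape.mem_cells.1 hc
  have h2 := rowLen_succ_le χ.outer i
  have h3 : (i, c) ∈ χ.cells := SkewShape.mem_cells.2 ⟨hi, by omega⟩
  exact ⟨h3, by have := T.col_strict i (i + 1) c (Nat.lt_succ_self i) h3 hc; omega⟩

theorem countMat_move {S : Finset (ℕ × ℕ)} {f : ℕ × ℕ → ℕ} {h h' : ℕ × ℕ} (hh : h ∈ S)
    (hh' : h' ∈ S) (hne : h ≠ h') (i a : ℕ) :
    countMat (S.erase h') (Function.update f h (f h')) i a = countMat (S.erase h) f i a
      + (if h.1 = i ∧ f h' = a then 1 else 0) - (if h'.1 = i ∧ f h' = a then 1 else 0) := by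
  have e1 : S.erase h' = insert h ((S.erase h).erase h') := by
    rw [Finset.erase_right_comm, Finset.insert_erase (Finset.mem_erase.2 ⟨hne, hh⟩)]
  have e2 : S.erase h = insert h' ((S.erase h).erase h') :=
    (Finset.insert_erase (Finset.mem_erase.2 ⟨hne.symm, hh'⟩)).symm
  have e3 : h ∉ (S.erase h).erase h' := by simp
  have e4 : h' ∉ (S.erase h).erase h' := by simp
  have e5 : countMat ((S.erase h).erase h') (Function.update f h (f h')) i a =
      countMat ((S.erase h).erase h') f i a := by
    rw [countMat_congr]
    intro c hc
    rw [Function.update_of_ne]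
    rintro rfl
    exact e3 hc
  have key : ∀ (A : Finset (ℕ × ℕ)) (x : ℕ × ℕ) (k : ℕ × ℕ → ℕ), x ∉ A →
      countMat (insert x A) k i a = countMat A k i a + if x.1 = i ∧ k x = a then 1 else 0 := by
    intro A x k hx
    simp only [countMat, Finset.filter_insert]
    split_ifs
    · rw [Finset.card_insert_of_notMem (fun h => hx (Finset.mem_filter.1 h).1)]; push_cast; rfl
    · simp
  rw [e1, key _ _ _ e3, e5, Function.update_self]
  conv_rhs => rw [e2, key _ _ _ e4]
  ring

/-- Only the square below the hole has nothing above it to compensate, so the excess is at most one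
over the usual bound; this is first attained at the value of the moving entry. -/
theorem IsPunctured.rowStep_up {θ : SkewShape} {i c : ℕ} {f : ℕ × ℕ → ℕ}
    (hp : IsPunctured θ (i, c) f) (hbelow : (i + 1, c) ∈ θ.outer)
    (hmin : (i, c + 1) ∈ θ.outer → f (i + 1, c) ≤ f (i, c + 1)) :
    RowStep i (rowLenInt θ.inner i - rowLenInt θ.inner (i + 1))
        (countMat (θ.cells.erase (i, c)) f)
        (countMat (θ.cells.erase (i + 1, c)) (Function.update f (i, c) (f (i + 1, c)))) ∧
      IsPunctured θ (i + 1, c) (Function.update f (i, c) (f (i + 1, c))) := by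
  have hole := SkewShape.mem_cells.1 hp.hole_mem
  rw [YoungDiagram.mem_iff_lt_rowLen] at hbelow
  have hin := rowLen_succ_le θ.inner i
  have hout := rowLen_succ_le θ.outer i
  have hnew : (i + 1, c) ∈ θ.cells := SkewShape.mem_cells.2 ⟨by omega, hbelow⟩
  have hne : (i + 1, c) ≠ (i, c) := by simp
  have hright : ∀ b, c < b → (i, b) ∈ θ.cells → f (i + 1, c) ≤ f (i, b) := by
    intro b hb hb'
    have h1 := SkewShape.mem_cells.1 hb'
    have h2 : (i, c + 1) ∈ θ.cells := SkewShape.mem_cells.2 ⟨by omega, by omega⟩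
    refine (hmin (by rw [YoungDiagram.mem_iff_lt_rowLen]; omega)).trans ?_
    rcases eq_or_lt_of_le (Nat.succ_le_of_lt hb) with rfl | h3
    · exact le_rfl
    · exact hp.row_weak i (c + 1) b h3 h2 (by simp) hb' (by simp; omega)
  have hbelow' : ∀ b, b ≠ c → (i, b) ∈ θ.cells → (i + 1, b) ∈ θ.cells →
      f (i, b) < f (i + 1, b) := fun b hb h1 h2 =>
    hp.col_strict i (i + 1) b (Nat.lt_succ_self i) h1 (by simpa using hb) h2 (by simp)
  have hle : ∀ b, b < c → (i + 1, b) ∈ θ.cells → f (i + 1, b) ≤ f (i + 1, c) := fun b hb h1 =>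
    hp.row_weak (i + 1) b c hb h1 (by simp) hnew hne
  have hleft : ∀ b, b < c → (i, b) ∈ θ.cells → f (i, b) < f (i + 1, c) := by
    intro b hb hb'
    have h1 := SkewShape.mem_cells.1 hb'
    have h2 : (i + 1, b) ∈ θ.cells := SkewShape.mem_cells.2 ⟨by omega, by omega⟩
    exact (hbelow' b hb.ne hb' h2).trans_le (hle b hb h2)
  refine ⟨⟨f (i + 1, c), ?_, ?_⟩, ?_⟩
  · funext a b
    rw [countMat_move hp.hole_mem hnew hne.symm, raiseRow]
    simp only [eq_comm]
  · have hup : ∀ b, rowExcess (countMat (θ.cells.erase (i, c)) f) i b ≤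
        rowLenInt θ.inner i - rowLenInt θ.inner (i + 1) + 1 := by
      intro j
      have hsub : lowCols (θ.cells.erase (i, c)) f (i + 1) (j + 1) ⊆
          insert c (Finset.Ico (θ.inner.rowLen (i + 1)) (θ.inner.rowLen i) ∪
            lowCols (θ.cells.erase (i, c)) f i j) := by
        intro b hb
        rw [mem_lowCols, Finset.mem_erase] at hb
        rw [Finset.mem_insert, Finset.mem_union, Finset.mem_Ico, mem_lowCols, Finset.mem_erase]
        have h1 := SkewShape.mem_cells.1 hb.1.2
        by_cases hbc : b = c
        · exact .inl hbc
        by_cases h2 : θ.inner.rowLen i ≤ b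
        · have h3 : (i, b) ∈ θ.cells := SkewShape.mem_cells.2 ⟨h2, by omega⟩
          have h4 := hbelow' b hbc h3 hb.1.2
          exact .inr (.inr ⟨⟨by simpa using hbc, h3⟩, by omega⟩)
        · exact .inr (.inl ⟨h1.1, by omega⟩)
      have h1 := (Finset.card_le_card hsub).trans
        ((Finset.card_insert_le _ _).trans (Nat.succ_le_succ (Finset.card_union_le _ _)))
      rw [Nat.card_Ico] at h1
      rw [rowExcess_countMat, rowLenInt, rowLenInt]
      omega
    refine ⟨le_antisymm (hup _) ?_, hup, fun j hj => Int.lt_add_one_of_le ?_⟩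
    -- At the value of the moving entry, row `i + 1` counts every column up to `c`, while row `i`
    -- counts only columns before `c`, by the choice of the smaller neighbour.
    · have hsub : insert c (Finset.Ico (θ.inner.rowLen (i + 1)) (θ.inner.rowLen i) ∪
            lowCols (θ.cells.erase (i, c)) f i (f (i + 1, c))) ⊆
          lowCols (θ.cells.erase (i, c)) f (i + 1) (f (i + 1, c) + 1) := by
        intro b hb
        rw [Finset.mem_insert, Finset.mem_union, Finset.mem_Ico, mem_lowCols,
          Finset.mem_erase] at hb
        rw [mem_lowCols, Finset.mem_erase]
        rcases hb with rfl | hb | ⟨⟨hb1, hb2⟩, hb3⟩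
        · exact ⟨⟨hne, hnew⟩, Nat.lt_succ_self _⟩
        · have h2 : (i + 1, b) ∈ θ.cells := SkewShape.mem_cells.2 ⟨hb.1, by omega⟩
          exact ⟨⟨by simp, h2⟩, Nat.lt_succ_of_le (hle b (by omega) h2)⟩
        · have h1 : b ≠ c := by rintro rfl; exact hb1 rfl
          have h2 : b < c := by
            by_contra h
            have := hright b (by omega) hb2
            omega
          have h3 := SkewShape.mem_cells.1 hb2
          have h4 : (i + 1, b) ∈ θ.cells := SkewShape.mem_cells.2 ⟨by omega, by omega⟩
          exact ⟨⟨by simp, h4⟩, Nat.lt_succ_of_le (hle b h2 h4)⟩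
      have hdisj : Disjoint (Finset.Ico (θ.inner.rowLen (i + 1)) (θ.inner.rowLen i))
          (lowCols (θ.cells.erase (i, c)) f i (f (i + 1, c))) := by
        rw [Finset.disjoint_left]
        intro b hb hb'
        rw [mem_lowCols, Finset.mem_erase] at hb'
        have := SkewShape.mem_cells.1 hb'.1.2
        have := Finset.mem_Ico.1 hb
        omega
      have hc : c ∉ Finset.Ico (θ.inner.rowLen (i + 1)) (θ.inner.rowLen i) ∪
            lowCols (θ.cells.erase (i, c)) f i (f (i + 1, c)) := by
        rw [Finset.mem_union, Finset.mem_Ico, mem_lowCols]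
        rintro (h | h)
        · omega
        · simp at h
      have h1 := Finset.card_le_card hsub
      rw [Finset.card_insert_of_notMem hc, Finset.card_union_of_disjoint hdisj,
        Nat.card_Ico] at h1
      rw [rowExcess_countMat, rowLenInt, rowLenInt]
      omega
    -- Below that value, column `c` is not counted and the usual bound returns.
    · refine rowExcess_le_of_subset (Finset.erase_subset _ _) fun b hb hb' hi => ?_
      have hb2 := (Finset.mem_erase.1 hb).2
      have h1 : b ≠ c := by rintro rfl; omega
      have h2 := SkewShape.mem_cells.1 hb2
      have h3 : (i, b) ∈ θ.cells := SkewShape.mem_cells.2 ⟨hi, by omega⟩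
      have h4 := hbelow' b h1 h3 hb2
      exact ⟨Finset.mem_erase.2 ⟨by simpa using h1, h3⟩, by omega⟩
  · refine ⟨hnew, ?_, ?_⟩
    · intro a b b' hbb hb hbh hb' hbh'
      simp only [Function.update_apply]
      split_ifs with h1 h2 h2
      · exact le_rfl
      · simp only [Prod.mk.injEq] at h1
        obtain ⟨rfl, rfl⟩ := h1
        exact hright b' hbb hb'
      · simp only [Prod.mk.injEq] at h2
        obtain ⟨rfl, rfl⟩ := h2
        exact (hleft b hbb hb).le
      · exact hp.row_weak a b b' hbb hb h1 hb' h2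
    · intro a a' b haa hb hbh hb' hbh'
      simp only [Function.update_apply]
      split_ifs with h1 h2 h2
      · simp only [Prod.mk.injEq] at h1 h2
        omega
      · simp only [Prod.mk.injEq] at h1
        obtain ⟨rfl, rfl⟩ := h1
        have : a + 1 ≠ a' := by rintro rfl; exact hbh' rfl
        exact hp.col_strict (a + 1) a' b (by omega) hnew hne hb' h2
      · simp only [Prod.mk.injEq] at h2
        obtain ⟨rfl, rfl⟩ := h2
        exact hp.col_strict a (a' + 1) b (by omega) hb h1 hnew hne
      · exact hp.col_strict a a' b haa hb h1 hb' h2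

theorem IsPunctured.left {θ : SkewShape} {i c : ℕ} {f : ℕ × ℕ → ℕ}
    (hp : IsPunctured θ (i, c) f) (hright : (i, c + 1) ∈ θ.outer)
    (hmin : (i + 1, c) ∈ θ.outer → f (i, c + 1) < f (i + 1, c)) :
    countMat (θ.cells.erase (i, c + 1)) (Function.update f (i, c) (f (i, c + 1))) =
        countMat (θ.cells.erase (i, c)) f ∧
      IsPunctured θ (i, c + 1) (Function.update f (i, c) (f (i, c + 1))) := by
  have hole := SkewShape.mem_cells.1 hp.hole_mem
  rw [YoungDiagram.mem_iff_lt_rowLen] at hright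
  have hnew : (i, c + 1) ∈ θ.cells := SkewShape.mem_cells.2 ⟨by omega, hright⟩
  have hne : (i, c + 1) ≠ (i, c) := by simp
  refine ⟨?_, hnew, ?_, ?_⟩
  · funext a b
    rw [countMat_move hp.hole_mem hnew hne.symm]
    ring
  · intro a b b' hbb hb hbh hb' hbh'
    simp only [Function.update_apply]
    split_ifs with h1 h2 h2
    · exact le_rfl
    · simp only [Prod.mk.injEq] at h1
      obtain ⟨rfl, rfl⟩ := h1
      have : b + 1 ≠ b' := by rintro rfl; exact hbh' rfl
      exact hp.row_weak a (b + 1) b' (by omega) hnew hne hb' h2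
    · simp only [Prod.mk.injEq] at h2
      obtain ⟨rfl, rfl⟩ := h2
      exact hp.row_weak a b (b' + 1) (by omega) hb h1 hnew hne
    · exact hp.row_weak a b b' hbb hb h1 hb' h2
  · intro a a' b haa hb hbh hb' hbh'
    simp only [Function.update_apply]
    have k1 := SkewShape.mem_cells.1 hb
    have k2 := SkewShape.mem_cells.1 hb'
    split_ifs with h1 h2 h2
    · simp only [Prod.mk.injEq] at h1 h2
      omega
    · simp only [Prod.mk.injEq] at h1
      obtain ⟨rfl, rfl⟩ := h1
      have k3 := θ.inner.rowLen_anti a (a + 1) (by omega)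
      have k4 := θ.outer.rowLen_anti (a + 1) a' (by omega)
      have k5 : (a + 1, b) ∈ θ.cells := SkewShape.mem_cells.2 ⟨by omega, by omega⟩
      refine (hmin (by rw [YoungDiagram.mem_iff_lt_rowLen]; omega)).trans_le ?_
      rcases eq_or_lt_of_le (Nat.succ_le_of_lt haa) with h3 | h3
      · rw [← h3]
      · exact (hp.col_strict (a + 1) a' b h3 k5 (by simp) hb' h2).le
    · simp only [Prod.mk.injEq] at h2
      obtain ⟨rfl, rfl⟩ := h2
      have k3 := θ.outer.rowLen_anti a a' haa.le
      have k4 : (a, b + 1) ∈ θ.cells := SkewShape.mem_cells.2 ⟨by omega, by omega⟩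
      exact (hp.row_weak a b (b + 1) (by omega) hb h1 k4 (by simp)).trans_lt
        (hp.col_strict a a' (b + 1) haa k4 (by simp) hnew hne)
    · exact hp.col_strict a a' b haa hb h1 hb' h2

/-- With nothing below the hole no column is uncompensated; this shows that the chain of a slide
cannot continue. -/
theorem IsPunctured.rowExcess_le {θ : SkewShape} {i c : ℕ} {f : ℕ × ℕ → ℕ}
    (hp : IsPunctured θ (i, c) f) (hbelow : (i + 1, c) ∉ θ.outer) (j : ℕ) :
    rowExcess (countMat (θ.cells.erase (i, c)) f) i j ≤
      rowLenInt θ.inner i - rowLenInt θ.inner (i + 1) := by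
  refine rowExcess_le_of_subset (Finset.erase_subset _ _) fun b hb hj hi => ?_
  have hb' := (Finset.mem_erase.1 hb).2
  have h1 := SkewShape.mem_cells.1 hb'
  have h2 := rowLen_succ_le θ.outer i
  rw [YoungDiagram.mem_iff_lt_rowLen] at hbelow
  have h3 : (i, b) ∈ θ.cells := SkewShape.mem_cells.2 ⟨hi, by omega⟩
  have h4 : (i, b) ≠ (i, c) := by
    intro h
    simp only [Prod.mk.injEq, true_and] at h
    omega
  refine ⟨Finset.mem_erase.2 ⟨h4, h3⟩, ?_⟩
  have := hp.col_strict i (i + 1) b (Nat.lt_succ_self i) h3 h4 hb' (Finset.mem_erase.1 hb).1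
  omega

theorem HoleMove.rowChain {θ : SkewShape} {x y : (ℕ × ℕ) × (ℕ × ℕ → ℕ)}
    (hxy : Relation.ReflTransGen (HoleMove θ.outer) x y) (hx : IsPunctured θ x.1 x.2) :
    RowChain (rowLenInt θ.inner) (x.1.1, countMat (θ.cells.erase x.1) x.2)
        (y.1.1, countMat (θ.cells.erase y.1) y.2) ∧
      IsPunctured θ y.1 y.2 := by
  induction hxy using Relation.ReflTransGen.head_induction_on with
  | refl => exact ⟨.refl, hx⟩
  | head h _ ih =>
    cases h with
    | up i c f hbelow hmin =>
      obtain ⟨h1, h2⟩ := hx.rowStep_up hbelow hmin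
      obtain ⟨h3, h4⟩ := ih h2
      exact ⟨.head (b := (i + 1, _)) ⟨rfl, h1⟩ h3, h4⟩
    | left i c f hright hmin =>
      obtain ⟨h1, h2⟩ := hx.left hright hmin
      obtain ⟨h3, h4⟩ := ih h2
      dsimp only at h1 h3
      rw [h1] at h3
      exact ⟨h3, h4⟩

theorem IsInwardSlide.rowChain {s t : ℕ × ℕ} {T T' : AnySkewTab} (h : IsInwardSlide s t T T') :
    RowChain (rowLenInt T'.1.inner) (s.1, countMat T.1.cells T.2.entry)
        (t.1, countMat T'.1.cells T'.2.entry) ∧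
      ∀ b, rowExcess (countMat T'.1.cells T'.2.entry) t.1 b ≤
        rowLenInt T'.1.inner t.1 - rowLenInt T'.1.inner (t.1 + 1) := by
  obtain ⟨hs, hinner, ht, houter, g, hg, hT'⟩ := h
  have hle : T'.1.inner.cells ⊆ T.1.inner.cells := by
    rw [hinner]; exact Finset.erase_subset _ _
  -- This shape contains both `s` and `t`: `T` is a filling with hole `s`, `T'` one with hole `t`,
  -- so a single inner partition governs the whole chain.
  let θ : SkewShape := ⟨T.1.outer, T'.1.inner, fun c hc => T.1.inner_le (hle hc)⟩
  have hsi : s ∉ T'.1.inner.cells := by simp [hinner]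
  have hso : s ∈ T.1.outer.cells := T.1.inner_le hs
  have e1 : θ.cells.erase s = T.1.cells := by
    ext x
    simp only [θ, SkewShape.cells, hinner, Finset.mem_erase, Finset.mem_sdiff]
    constructor
    · rintro ⟨h1, h2, h3⟩
      exact ⟨h2, fun h => h3 ⟨h1, h⟩⟩
    · rintro ⟨h1, h2⟩
      exact ⟨by rintro rfl; exact h2 hs, h1, fun h => h2 h.2⟩
  have e2 : θ.cells.erase t = T'.1.cells := by
    simp only [θ, SkewShape.cells, houter]
    exact (Finset.erase_sdiff_comm _ _ _).symm
  have hmem : ∀ x ∈ θ.cells, x ≠ s → x ∈ T.1.cells := fun x h h' => by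
    rw [← e1]; exact Finset.mem_erase.2 ⟨h', h⟩
  have hp : IsPunctured θ s T.2.entry :=
    ⟨Finset.mem_sdiff.2 ⟨hso, hsi⟩,
      fun i c c' hc h1 h2 h3 h4 => T.2.row_weak i c c' hc (hmem _ h1 h2) (hmem _ h3 h4),
      fun i i' c hc h1 h2 h3 h4 => T.2.col_strict i i' c hc (hmem _ h1 h2) (hmem _ h3 h4)⟩
  obtain ⟨h1, h2⟩ := HoleMove.rowChain (θ := θ) hg hp
  have e3 : countMat T'.1.cells T'.2.entry = countMat (θ.cells.erase t) g := by
    rw [e2]; exact countMat_congr hT'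
  dsimp only at h1 h2
  rw [e1] at h1
  rw [e3]
  refine ⟨h1, h2.rowExcess_le ?_⟩
  intro hb
  have h5 : (t.1 + 1, t.2) ∈ T'.1.outer.cells := by
    rw [houter]
    exact Finset.mem_erase.2 ⟨fun h => by simpa using congrArg Prod.fst h, hb⟩
  have h6 : t ∈ T'.1.outer.cells := T'.1.outer.isLowerSet
    (show t ≤ (t.1 + 1, t.2) from ⟨Nat.le_succ _, le_rfl⟩) h5
  rw [houter] at h6
  simp at h6

theorem rowLen_of_cells_eq_erase {μ μ' : YoungDiagram} {s : ℕ × ℕ} (hs : s ∈ μ)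
    (h : μ'.cells = μ.cells.erase s) :
    μ.rowLen s.1 = s.2 + 1 ∧ μ'.rowLen s.1 = s.2 ∧
      ∀ i, i ≠ s.1 → μ'.rowLen i = μ.rowLen i := by
  have key : ∀ i c, c < μ'.rowLen i ↔ (i, c) ≠ s ∧ c < μ.rowLen i := by
    intro i c
    rw [← YoungDiagram.mem_iff_lt_rowLen, ← YoungDiagram.mem_iff_lt_rowLen,
      ← YoungDiagram.mem_cells, h, Finset.mem_erase, YoungDiagram.mem_cells]
  obtain ⟨a, b⟩ := s
  rw [YoungDiagram.mem_iff_lt_rowLen] at hs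
  simp only [ne_eq, Prod.mk.injEq, not_and] at key ⊢
  have h1 := key a b
  have h2 : μ'.rowLen a ≤ b := by
    by_contra hc
    exact (h1.1 (by omega)).1 rfl rfl
  refine ⟨?_, ?_, fun i hi => ?_⟩
  · by_contra hne
    have := (key a (b + 1)).2 ⟨by omega, by omega⟩
    omega
  · by_contra hne
    have := (key a (μ'.rowLen a)).2 ⟨by omega, by omega⟩
    omega
  · have h3 := key i (μ'.rowLen i)
    have h4 := key i (μ.rowLen i)
    simp only [hi, false_imp_iff, true_and, lt_irrefl, iff_false, false_iff] at h3 h4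
    omega

/-! ### Dominance in terms of matrices -/

theorem sum_countMat_eventually (χ : SkewShape) (f : ℕ × ℕ → ℕ) (i : ℕ) :
    ∀ᶠ k in Filter.atTop, ∑ b ∈ Finset.range k, countMat χ.cells f i b =
      rowLenInt χ.outer i - rowLenInt χ.inner i := by
  filter_upwards [Filter.eventually_gt_atTop (χ.cells.sup f)] with k hk
  have h1 : lowCols χ.cells f i k = Finset.Ico (χ.inner.rowLen i) (χ.outer.rowLen i) := by
    ext c
    rw [mem_lowCols, Finset.mem_Ico, SkewShape.mem_cells]
    refine and_iff_left_of_imp fun h => ?_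
    exact (Finset.le_sup (f := f) (SkewShape.mem_cells.2 h)).trans_lt hk
  have h2 : χ.inner.rowLen i ≤ χ.outer.rowLen i := by
    by_contra hc
    have h3 : (i, χ.outer.rowLen i) ∈ χ.inner := by
      rw [YoungDiagram.mem_iff_lt_rowLen]; omega
    have h4 := χ.inner_le h3
    rw [YoungDiagram.mem_iff_lt_rowLen] at h4
    omega
  rw [← card_lowCols, h1, Nat.card_Ico, rowLenInt, rowLenInt]
  omega

/-- A matrix of natural numbers that satisfies the dominance conditions for a skew shape is the
matrix of row contents of a tableau of that shape. -/
theorem exists_skewTab_of_rowExcess_le (σ : SkewShape) (N : ℕ → ℕ → ℕ)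
    (hN : ∀ a i, rowExcess (fun a i => (N a i : ℤ)) a i ≤
      rowLenInt σ.inner a - rowLenInt σ.inner (a + 1))
    (hsum : ∀ a, ∀ᶠ k in Filter.atTop, ∑ i ∈ Finset.range k, (N a i : ℤ) =
      rowLenInt σ.outer a - rowLenInt σ.inner a) :
    ∃ U : SkewTab σ, ∀ a i, U.rowCount a i = N a i := by
  classical
  -- `Q a i` is the column at which the entries at least `i` of row `a` must begin.
  set Q : ℕ → ℕ → ℕ := fun a i => σ.inner.rowLen a + ∑ k ∈ Finset.range i, N a k with hQ
  have hQ0 : ∀ a, Q a 0 = σ.inner.rowLen a := fun a => by simp [hQ]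
  have hQs : ∀ a i, Q a (i + 1) = Q a i + N a i := fun a i => by
    simp only [hQ, Finset.sum_range_succ]; ring
  have hmono : ∀ a, Monotone (Q a) := fun a =>
    monotone_nat_of_le_succ fun i => by rw [hQs]; exact Nat.le_add_right _ _
  have hev : ∀ a, ∀ᶠ k in Filter.atTop, Q a k = σ.outer.rowLen a := by
    intro a
    filter_upwards [hsum a] with k hk
    rw [rowLenInt, rowLenInt] at hk
    rw [← Nat.cast_sum] at hk
    simp only [hQ]
    omega
  have hQle : ∀ a i, Q a i ≤ σ.outer.rowLen a := by
    intro a i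
    obtain ⟨k, hk, hik⟩ := ((hev a).and (Filter.eventually_ge_atTop i)).exists
    exact hk ▸ hmono a hik
  have hex : ∀ a c, (a, c) ∈ σ.cells → ∃ i, c < Q a (i + 1) := by
    intro a c hc
    obtain ⟨k, hk, hk1⟩ := ((hev a).and (Filter.eventually_ge_atTop 1)).exists
    refine ⟨k - 1, ?_⟩
    rw [Nat.sub_add_cancel hk1, hk]
    exact (SkewShape.mem_cells.1 hc).2
  -- The excess bound in this form is column strictness.
  have hstep : ∀ a i, Q (a + 1) (i + 1) ≤ Q a i := by
    intro a i
    have := hN a i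
    rw [rowExcess, rowLenInt, rowLenInt] at this
    rw [← Nat.cast_sum, ← Nat.cast_sum] at this
    simp only [hQ]
    omega
  let e : ℕ × ℕ → ℕ := fun x =>
    if h : ∃ i, x ∈ σ.cells ∧ x.2 < Q x.1 (i + 1) then Nat.find h else 0
  have he : ∀ a c i, (a, c) ∈ σ.cells → (e (a, c) ≤ i ↔ c < Q a (i + 1)) := by
    intro a c i hc
    obtain ⟨k, hk⟩ := hex a c hc
    have h : ∃ i, (a, c) ∈ σ.cells ∧ c < Q a (i + 1) := ⟨k, hc, hk⟩
    have : e (a, c) = Nat.find h := dif_pos h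
    rw [this, Nat.find_le_iff]
    constructor
    · rintro ⟨m, hm, -, h⟩
      exact h.trans_le (hmono a (by omega))
    · exact fun h => ⟨i, le_rfl, hc, h⟩
  have hcol : ∀ a c, (a, c) ∈ σ.cells → (a + 1, c) ∈ σ.cells → e (a, c) < e (a + 1, c) := by
    intro a c h1 h2
    have h3 := ((he (a + 1) c _ h2).1 le_rfl).trans_le (hstep a _)
    have h4 := (SkewShape.mem_cells.1 h1).1
    rcases Nat.eq_zero_or_pos (e (a + 1, c)) with h5 | h5
    · rw [h5, hQ0] at h3
      omega
    · have := (he a c (e (a + 1, c) - 1) h1).2 (by rwa [Nat.sub_add_cancel h5])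
      omega
  refine ⟨⟨e, ?_, ?_, ?_⟩, ?_⟩
  · intro i j j' hj h1 h2
    rw [he i j _ h1]
    exact hj.trans ((he i j' _ h2).1 le_rfl)
  · intro i i' j hi h1 h2
    induction i', hi using Nat.le_induction with
    | base => exact hcol i j h1 h2
    | succ k hk ih =>
      have h3 := SkewShape.mem_cells.1 h1
      have h4 := SkewShape.mem_cells.1 h2
      have h5 := rowLen_succ_le σ.outer k
      have h6 := σ.inner.rowLen_anti i k (by omega)
      have h7 : (k, j) ∈ σ.cells := SkewShape.mem_cells.2 ⟨by omega, by omega⟩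
      exact (ih h7).trans (hcol k j h7 h2)
  · intro c hc
    exact dif_neg fun ⟨_, h, _⟩ => hc h
  · intro a i
    have h1 : σ.cells.filter (fun c => c.1 = a ∧ e c = i) =
        (Finset.Ico (Q a i) (Q a (i + 1))).image (Prod.mk a) := by
      ext ⟨x, c⟩
      simp only [Finset.mem_filter, Finset.mem_image, Finset.mem_Ico, Prod.mk.injEq]
      have hlow : ∀ hc : (a, c) ∈ σ.cells, i ≤ e (a, c) ↔ Q a i ≤ c := by
        intro hc
        rcases i with _ | k
        · simp only [Nat.zero_le, hQ0, true_iff]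
          exact (SkewShape.mem_cells.1 hc).1
        · have := he a c k hc
          omega
      constructor
      · rintro ⟨hc, rfl, h⟩
        have h1 := he x c i hc
        have h2 := hlow hc
        exact ⟨c, ⟨by omega, by omega⟩, rfl, rfl⟩
      · rintro ⟨c, ⟨h1, h2⟩, rfl, rfl⟩
        have h3 := hmono a (Nat.zero_le i)
        rw [hQ0] at h3
        have h4 := hQle a (i + 1)
        have hc : (a, c) ∈ σ.cells := SkewShape.mem_cells.2 ⟨by omega, by omega⟩
        have h5 := he a c i hc
        have h6 := hlow hc
        exact ⟨hc, rfl, by omega⟩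
    rw [SkewTab.rowCount, h1, Finset.card_image_of_injective _ (Prod.mk_right_injective a),
      Nat.card_Ico, hQs]
    omega

theorem IsCompanion.countMat_eq {χ σ : SkewShape} {T : SkewTab χ} {U : SkewTab σ}
    (h : IsCompanion T U) : countMat σ.cells U.entry = swapMat (countMat χ.cells T.entry) := by
  funext a i
  have := h i a
  rw [SkewTab.rowCount, SkewTab.rowCount] at this
  rw [swapMat, countMat, countMat, this]

theorem isDominant_iff {χ : SkewShape} (T : SkewTab χ) (σ : SkewShape) :
    IsDominant T σ ↔
      (∀ a i, rowExcess (swapMat (countMat χ.cells T.entry)) a i ≤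
        rowLenInt σ.inner a - rowLenInt σ.inner (a + 1)) ∧
      ∀ a, ∀ᶠ k in Filter.atTop,
        ∑ i ∈ Finset.range k, swapMat (countMat χ.cells T.entry) a i =
          rowLenInt σ.outer a - rowLenInt σ.inner a := by
  constructor
  · rintro ⟨U, hU⟩
    rw [← hU.countMat_eq]
    exact ⟨U.rowExcess_le, sum_countMat_eventually σ U.entry⟩
  · rintro ⟨h1, h2⟩
    obtain ⟨U, hU⟩ := exists_skewTab_of_rowExcess_le σ (fun a i => T.rowCount i a) h1 h2
    exact ⟨U, fun i a => (hU a i).symm⟩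

/-! ### Slides of tableaux with column-equivalent matrices -/

/-- The matrix of row contents of a tableau. -/
def AnySkewTab.mat (T : AnySkewTab) : ℕ → ℕ → ℤ := countMat T.1.cells T.2.entry

theorem IsSlideSeq.colEquiv_swapMat {p : List JdtSlide} {T T' : AnySkewTab}
    (h : IsSlideSeq p T T') : ColEquiv (swapMat T.mat) (swapMat T'.mat) := by
  induction h with
  | nil => exact .refl
  | cons d p T U V h _ ih =>
    refine Relation.ReflTransGen.trans ?_ ih
    cases d with
    | inward s =>
      obtain ⟨t, h⟩ := h
      exact h.rowChain.1.colEquiv_swapMat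
    | outward t =>
      obtain ⟨s, h⟩ := h
      exact h.rowChain.1.colEquiv_swapMat.symm

theorem SkewShape.ext_cells {χ χ' : SkewShape} (h1 : χ.outer.cells = χ'.outer.cells)
    (h2 : χ.inner.cells = χ'.inner.cells) : χ = χ' := by
  obtain ⟨a, b, _⟩ := χ
  obtain ⟨a', b', _⟩ := χ'
  obtain rfl : a = a' := YoungDiagram.ext h1
  obtain rfl : b = b' := YoungDiagram.ext h2
  rfl

/-- Column operators carry the chain of `U` to one starting at the matrix of `V`. Both this and the
chain of `V` cannot be continued, so they end in the same row with the same matrix. -/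
theorem IsInwardSlide.colEquiv {s t t' : ℕ × ℕ} {U V U' V' : AnySkewTab}
    (hU : IsInwardSlide s t U U') (hV : IsInwardSlide s t' V V') (hshape : U.1 = V.1)
    (h : ColEquiv U.mat V.mat) : U'.1 = V'.1 ∧ ColEquiv U'.mat V'.mat := by
  have hin : U'.1.inner = V'.1.inner := YoungDiagram.ext (by rw [hU.2.1, hV.2.1, hshape])
  obtain ⟨cU, tU⟩ := hU.rowChain
  obtain ⟨cV, tV⟩ := hV.rowChain
  obtain ⟨N, cN, hN⟩ := cU.colEquiv_right h
  rw [← hin] at cV tV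
  have heq := cN.unique cV ((hN.rowExcess_le_iff _ _).2 tU) tV
  simp only [Prod.mk.injEq] at heq
  obtain ⟨ht, rfl⟩ := heq
  have h1 := (rowLen_of_cells_eq_erase hU.2.2.1 hU.2.2.2.1).1
  have h2 := (rowLen_of_cells_eq_erase hV.2.2.1 hV.2.2.2.1).1
  -- A corner of the common outer partition is determined by its row.
  have htt : t = t' := by
    refine Prod.ext ht ?_
    rw [hshape, ht] at h1
    omega
  refine ⟨SkewShape.ext_cells ?_ (congrArg _ hin), hN⟩
  rw [hU.2.2.2.1, hV.2.2.2.1, hshape, htt]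

/-- The inner partition of `U` has the extra square `s` in row `i + 1`, so its own bound is one
sharper. This prevents a chain from being prolonged backwards past `s`. -/
theorem IsInwardSlide.rowExcess_lt {s t : ℕ × ℕ} {U U' : AnySkewTab}
    (hU : IsInwardSlide s t U U') (i : ℕ) (hi : s.1 = i + 1) (b : ℕ) :
    rowExcess U.mat i b < rowLenInt U'.1.inner i - rowLenInt U'.1.inner (i + 1) := by
  obtain ⟨h1, h2, h3⟩ := rowLen_of_cells_eq_erase hU.1 hU.2.1
  have h4 := h3 i (by omega)
  have h5 := U.2.rowExcess_le i b
  rw [rowLenInt, rowLenInt] at h5 ⊢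
  rw [hi] at h1 h2
  rw [AnySkewTab.mat]
  omega

/-- The chains are followed backwards; the strict bound, also preserved by column operators, fixes
the row in which they begin. -/
theorem IsInwardSlide.colEquiv_left {s s' t : ℕ × ℕ} {U V U' V' : AnySkewTab}
    (hU : IsInwardSlide s t U U') (hV : IsInwardSlide s' t V V') (hshape : U'.1 = V'.1)
    (h : ColEquiv U'.mat V'.mat) : U.1 = V.1 ∧ ColEquiv U.mat V.mat := by
  obtain ⟨cU, -⟩ := hU.rowChain
  obtain ⟨cV, -⟩ := hV.rowChain
  obtain ⟨N, cN, hN⟩ := cU.colEquiv_left h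
  rw [← congrArg SkewShape.inner hshape] at cV
  have hlt : ∀ i, s.1 = i + 1 → ∀ b,
      rowExcess N i b < rowLenInt U'.1.inner i - rowLenInt U'.1.inner (i + 1) := by
    intro i hi b
    exact Int.lt_of_le_sub_one ((hN.rowExcess_le_iff i _).2
      (fun b => Int.le_sub_one_of_lt (hU.rowExcess_lt i hi b)) b)
  have heq := cN.unique_left cV hlt fun i hi b => by
    rw [hshape]
    exact hV.rowExcess_lt i hi b
  simp only [Prod.mk.injEq] at heq
  obtain ⟨hs, rfl⟩ := heq
  have h1 := (rowLen_of_cells_eq_erase hU.1 hU.2.1).2.1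
  have h2 := (rowLen_of_cells_eq_erase hV.1 hV.2.1).2.1
  have hss : s = s' := by
    refine Prod.ext hs ?_
    rw [hshape, hs] at h1
    omega
  refine ⟨SkewShape.ext_cells ?_ ?_, hN⟩
  · rw [← Finset.insert_erase (show t ∈ U.1.outer.cells from hU.2.2.1), ← hU.2.2.2.1, hshape,
      hV.2.2.2.1, Finset.insert_erase (show t ∈ V.1.outer.cells from hV.2.2.1)]
  · rw [← Finset.insert_erase (show s ∈ U.1.inner.cells from hU.1), ← hU.2.1, hshape,
      hV.2.1, hss, Finset.insert_erase (show s' ∈ V.1.inner.cells from hV.1)]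

theorem IsSlideSeq.shape_eq {p : List JdtSlide} {U V U' V' : AnySkewTab}
    (hU : IsSlideSeq p U U') (hV : IsSlideSeq p V V') (hshape : U.1 = V.1)
    (h : ColEquiv U.mat V.mat) : U'.1 = V'.1 := by
  induction hU generalizing V with
  | nil => cases hV; exact hshape
  | cons d p U W U' hd _ ih =>
    cases hV with
    | cons _ _ _ X _ hd' hp' =>
      cases d with
      | inward s =>
        obtain ⟨t, hd⟩ := hd
        obtain ⟨t', hd'⟩ := hd'
        obtain ⟨h1, h2⟩ := hd.colEquiv hd' hshape h
        exact ih hp' h1 h2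
      | outward t =>
        obtain ⟨s, hd⟩ := hd
        obtain ⟨s', hd'⟩ := hd'
        obtain ⟨h1, h2⟩ := hd.colEquiv_left hd' hshape h
        exact ih hp' h1 h2

theorem IsDominant.of_colEquiv {χ χ' : SkewShape} {T : SkewTab χ} {T' : SkewTab χ'}
    (h : ColEquiv (swapMat (countMat χ.cells T.entry)) (swapMat (countMat χ'.cells T'.entry)))
    {σ : SkewShape} (hT : IsDominant T σ) : IsDominant T' σ := by
  rw [isDominant_iff] at hT ⊢
  exact ⟨fun a => (h.rowExcess_le_iff a _).2 (hT.1 a), fun a => h.sum_row a _ (hT.2 a)⟩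

theorem mainTheorem7 {χ χ' : SkewShape} (T : SkewTab χ) (T' : SkewTab χ')
    (hTT' : JdtEquiv T T') (σ : SkewShape) :
    (IsDominant T σ ↔ IsDominant T' σ) ∧
      (IsDominant T σ →
        ∀ U U' : SkewTab σ, IsCompanion T U → IsCompanion T' U' → DualEquiv U U') := by
  obtain ⟨p, hp⟩ := hTT'
  have h := hp.colEquiv_swapMat
  refine ⟨⟨.of_colEquiv h, .of_colEquiv h.symm⟩, fun _ U U' hU hU' q V V' hV hV' => ?_⟩
  refine hV.shape_eq hV' rfl ?_
  simp only [AnySkewTab.mat] at h ⊢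
  rwa [hU.countMat_eq, hU'.countMat_eq]
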